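/- For positive integers $\alpha_1,\dots,\alpha_r$ with $\alpha_r\ge 2$ put $$\zeta(\alpha_1,\dots,\alpha_r)=\sum_{1\le k_1<k_2<\cdots<k_r}k_1^{-\alpha_1}\cdots k_r^{-\alpha_r},\qquad \zeta^\star(\alpha_1,\dots,\alpha_r)=\sum_{1\le k_1\le k_2\le\cdots\le k_r}k_1^{-\alpha_1}\cdots k_r^{-\alpha_r},$$ with $\zeta(\emptyset)=\zeta^\star(\emptyset)=1$, and let $\{2\}^m$ denote the index $(2,2,\dots,2)$ with $m$ entries. Then for every integer $n\ge 0$ all the series below converge and $$\zeta(2n+2)=\sum_{\substack{a+b=n\\ a,b\ge 0}}(-1)^b\,(b+1)\,\zeta(\{2\}^{b+1})\,\zeta^\star(\{2\}^a).$$ -/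

import Mathlib

/-- The summand `k₁^{-α₁} k₂^{-α₂} ⋯ k_r^{-α_r}` attached to an index `α = (α₁, …, α_r)`
and a tuple `k = (k₁, …, k_r)` of positive integers. It is `1` when `r = 0`. -/
noncomputable def mzvTerm {r : ℕ} (α : Fin r → ℕ) (k : Fin r → ℕ+) : ℝ :=
  ∏ i, (((k i : ℕ) : ℝ) ^ α i)⁻¹

/-- The multiple zeta value `ζ(α₁, …, α_r)`: the sum of `k₁^{-α₁} ⋯ k_r^{-α_r}` over all
`1 ≤ k₁ < k₂ < ⋯ < k_r`. For the empty index it is `1`. -/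
noncomputable def mzv {r : ℕ} (α : Fin r → ℕ) : ℝ :=
  ∑' k : {k : Fin r → ℕ+ // StrictMono k}, mzvTerm α k.1

/-- The multiple zeta-star value `ζ⋆(α₁, …, α_r)`: the sum of `k₁^{-α₁} ⋯ k_r^{-α_r}` over all
`1 ≤ k₁ ≤ k₂ ≤ ⋯ ≤ k_r`. For the empty index it is `1`. -/
noncomputable def mzsv {r : ℕ} (α : Fin r → ℕ) : ℝ :=
  ∑' k : {k : Fin r → ℕ+ // Monotone k}, mzvTerm α k.1

/-- Convergence of the series that defines `mzv α`. -/
def MZVConverges {r : ℕ} (α : Fin r → ℕ) : Prop :=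
  Summable fun k : {k : Fin r → ℕ+ // StrictMono k} => mzvTerm α k.1

/-- Convergence of the series that defines `mzsv α`. -/
def MZSVConverges {r : ℕ} (α : Fin r → ℕ) : Prop :=
  Summable fun k : {k : Fin r → ℕ+ // Monotone k} => mzvTerm α k.1

/-- The index `{s}^m = (s, s, …, s)` with `m` entries. -/
def repIndex (s m : ℕ) : Fin m → ℕ := fun _ => s

/-- In depth one, multiple zeta values are the values of the Riemann zeta function. -/
theorem mzv_depth_one (s : ℕ) (hs : 2 ≤ s) : ((mzv ![s] : ℝ) : ℂ) = riemannZeta s := by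
  have hmono : ∀ k : Fin 1 → ℕ+, StrictMono k := fun k => Subsingleton.strictMono k
  have e1 : mzv ![s] = ∑' n : ℕ+, (((n : ℕ) : ℝ) ^ s)⁻¹ := by
    unfold mzv
    rw [← ((Equiv.subtypeUnivEquiv hmono).trans (Equiv.funUnique (Fin 1) ℕ+)).tsum_eq]
    refine tsum_congr fun k => ?_
    simp [mzvTerm]
  rw [e1, zeta_nat_eq_tsum_of_gt_one (by omega)]
  rw [tsum_pnat_eq_tsum_succ (f := fun n : ℕ => ((n : ℝ) ^ s)⁻¹)]
  have hsum : Summable fun n : ℕ => 1 / (n : ℂ) ^ s := by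
    have h := (Real.summable_one_div_nat_pow (p := s)).2 (by omega)
    simpa using (Complex.summable_ofReal (f := fun n : ℕ => 1 / (n : ℝ) ^ s)).2 h
  rw [hsum.tsum_eq_zero_add]
  push_cast
  simp [show s ≠ 0 by omega]

open Filter Topology PowerSeries

/-! Restrict all entries to `k ≤ N` and put `x k = k⁻²`. The truncated sums are then the elementary,
complete homogeneous and power sums of finitely many numbers, with E = ∏ (1 - x k X) and H = 1/E.
The logarithmic derivative -E'/E = -E' H equals ∑ x k / (1 - x k X)
(`neg_derivative_elemSeries_mul_homSeries`). Its coefficient at X^n is the truncated identity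
`sum_pow_eq_sum_antidiagonal`; `tendsto_truncSum` lets N tend to infinity. -/

/-- The positive integers up to `N`. -/
def pnatUpTo (N : ℕ) : Finset ℕ+ := (Finset.range N).image Nat.succPNat

theorem mem_pnatUpTo {N : ℕ} {k : ℕ+} : k ∈ pnatUpTo N ↔ (k : ℕ) ≤ N := by
  simp only [pnatUpTo, Finset.mem_image, Finset.mem_range]
  constructor
  · rintro ⟨a, ha, rfl⟩
    simpa using ha
  · intro h
    have := k.pos
    exact ⟨k.natPred, by simp [PNat.natPred]; omega, by simp⟩

theorem pnatUpTo_succ (N : ℕ) :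
    pnatUpTo (N + 1) = insert N.succPNat (pnatUpTo N) := by
  simp [pnatUpTo, Finset.range_add_one]

theorem succPNat_notMem_pnatUpTo (N : ℕ) : N.succPNat ∉ pnatUpTo N := by
  simp [mem_pnatUpTo]

theorem pnatUpTo_mono : Monotone pnatUpTo := fun _ _ h _ hk =>
  mem_pnatUpTo.2 ((mem_pnatUpTo.1 hk).trans h)

/-- The tuples of positive integers with all entries at most `N`. -/
def pnatBox (m N : ℕ) : Finset (Fin m → ℕ+) := Fintype.piFinset fun _ => pnatUpTo N

theorem mem_pnatBox {m N : ℕ} {k : Fin m → ℕ+} : k ∈ pnatBox m N ↔ ∀ i, (k i : ℕ) ≤ N := by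
  simp [pnatBox, mem_pnatUpTo]

theorem tendsto_pnatBox (m : ℕ) : Tendsto (pnatBox m) atTop atTop := by
  refine tendsto_atTop_finset_of_monotone
    (fun a b h => Fintype.piFinset_subset _ _ fun _ => pnatUpTo_mono h) fun k => ?_
  exact ⟨∑ i, (k i : ℕ), mem_pnatBox.2 fun i =>
    Finset.single_le_sum (f := fun i => (k i : ℕ)) (fun _ _ => Nat.zero_le _) (Finset.mem_univ i)⟩

/-- A product of summable nonnegative families is summable over the tuples of indices. -/
theorem summable_prod_pnat {m : ℕ} {f : Fin m → ℕ+ → ℝ} (hf : ∀ i k, 0 ≤ f i k)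
    (hs : ∀ i, Summable (f i)) : Summable fun k : Fin m → ℕ+ => ∏ i, f i (k i) := by
  classical
  refine summable_of_sum_le (c := ∏ i, ∑' k, f i k)
    (fun k => Finset.prod_nonneg fun i _ => hf i _) fun u => ?_
  -- A finite set of tuples lies in the box of its coordinate projections, over which the sum
  -- factors.
  have hu : u ⊆ Fintype.piFinset fun i => u.image fun k => k i := fun k hk =>
    Fintype.mem_piFinset.2 fun i => Finset.mem_image_of_mem (fun k : Fin m → ℕ+ => k i) hk
  calc ∑ k ∈ u, ∏ i, f i (k i)
      ≤ ∑ k ∈ Fintype.piFinset fun i => u.image fun k => k i, ∏ i, f i (k i) :=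
        Finset.sum_le_sum_of_subset_of_nonneg hu
          fun k _ _ => Finset.prod_nonneg fun i _ => hf i _
    _ = ∏ i, ∑ k ∈ u.image fun k => k i, f i k := (Finset.prod_univ_sum _ _).symm
    _ ≤ ∏ i, ∑' k, f i k := Finset.prod_le_prod
        (fun i _ => Finset.sum_nonneg fun k _ => hf i k)
        fun i _ => (hs i).sum_le_tsum _ fun k _ => hf i k

theorem summable_pnat_inv_pow {s : ℕ} (hs : 2 ≤ s) :
    Summable fun k : ℕ+ => (((k : ℕ) : ℝ) ^ s)⁻¹ :=
  (Real.summable_nat_pow_inv.2 (by omega)).comp_injective PNat.coe_injective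

theorem summable_mzvTerm {m : ℕ} {α : Fin m → ℕ} (hα : ∀ i, 2 ≤ α i) : Summable (mzvTerm α) :=
  summable_prod_pnat (f := fun i k => (((k : ℕ) : ℝ) ^ α i)⁻¹) (fun _ _ => by positivity)
    fun i => summable_pnat_inv_pow (hα i)

/-- The sum of `x (k 0) * ⋯ * x (k (m - 1))` over the tuples with entries at most `N` that
satisfy `p`. -/
noncomputable def truncSum (x : ℕ+ → ℝ) {m : ℕ} (p : (Fin m → ℕ+) → Prop) (N : ℕ) : ℝ :=
  open scoped Classical in ∑ k ∈ pnatBox m N with p k, ∏ i, x (k i)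

theorem tendsto_truncSum {x : ℕ+ → ℝ} {m : ℕ} (p : (Fin m → ℕ+) → Prop)
    (h : Summable fun k : Fin m → ℕ+ => ∏ i, x (k i)) :
    Tendsto (truncSum x p) atTop (𝓝 (∑' k : {k // p k}, ∏ i, x (k.1 i))) := by
  classical
  have h1 := (h.indicator {k | p k}).hasSum.comp (tendsto_pnatBox m)
  have h2 := tsum_subtype {k | p k} fun k : Fin m → ℕ+ => ∏ i, x (k i)
  rw [← h2] at h1
  refine h1.congr fun N => ?_
  simp only [Function.comp, truncSum, Finset.sum_filter, Set.indicator_apply, Set.mem_ofPred_eq]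

theorem truncSum_depth_zero (x : ℕ+ → ℝ) {p : (Fin 0 → ℕ+) → Prop} (hp : ∀ k, p k) (N : ℕ) :
    truncSum x p N = 1 := by
  simp [truncSum, pnatBox, hp]

theorem truncSum_zero (x : ℕ+ → ℝ) {m : ℕ} (p : (Fin (m + 1) → ℕ+) → Prop) :
    truncSum x p 0 = 0 := by
  simp [truncSum, pnatBox, pnatUpTo]

/-- Splitting a truncated sum by whether the last entry is the largest one allowed. -/
theorem truncSum_succ (x : ℕ+ → ℝ) {m N M : ℕ} {p : (Fin (m + 1) → ℕ+) → Prop}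
    {q : (Fin m → ℕ+) → Prop} (hp : ∀ k, p k → Monotone k)
    (hq : ∀ k : Fin m → ℕ+, (k ∈ pnatBox m M ∧ q k) ↔
      (k ∈ pnatBox m (N + 1) ∧ p (Fin.snoc k N.succPNat))) :
    truncSum x p (N + 1) = truncSum x p N + x N.succPNat * truncSum x q M := by
  classical
  rw [truncSum, ← Finset.sum_filter_add_sum_filter_not _ fun k => (k (Fin.last m) : ℕ) ≤ N]
  congr 1
  · rw [truncSum]
    refine Finset.sum_congr ?_ fun _ _ => rfl
    ext k
    simp only [Finset.mem_filter, mem_pnatBox]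
    constructor
    · rintro ⟨⟨_, hk⟩, hl⟩
      exact ⟨fun i => le_trans (PNat.coe_le_coe _ _ |>.2 (hp k hk (Fin.le_last i))) hl, hk⟩
    · rintro ⟨h, hk⟩
      exact ⟨⟨fun i => (h i).trans (Nat.le_succ N), hk⟩, h _⟩
  · rw [truncSum, Finset.mul_sum]
    have last_eq : ∀ k : Fin (m + 1) → ℕ+, k ∈ pnatBox (m + 1) (N + 1) →
        ¬ (k (Fin.last m) : ℕ) ≤ N → k (Fin.last m) = N.succPNat := fun k hk hl => by
      have := mem_pnatBox.1 hk (Fin.last m)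
      exact PNat.eq (by rw [Nat.succPNat_coe]; omega)
    refine Finset.sum_bij' (fun k _ => Fin.init k)
      (fun k _ => (Fin.snoc k N.succPNat : Fin (m + 1) → ℕ+)) ?_ ?_ ?_ ?_ ?_
    · intro k hk
      simp only [Finset.mem_filter] at hk ⊢
      have h := last_eq k hk.1.1 hk.2
      rw [hq, ← h, Fin.snoc_init_self]
      exact ⟨mem_pnatBox.2 fun i => mem_pnatBox.1 hk.1.1 _, hk.1.2⟩
    · intro k hk
      simp only [Finset.mem_filter] at hk ⊢
      rw [hq] at hk
      refine ⟨⟨mem_pnatBox.2 fun i => ?_, hk.2⟩, by simp⟩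
      induction i using Fin.lastCases with
      | last => simp
      | cast i => simpa using mem_pnatBox.1 hk.1 i
    · intro k hk
      simp only [Finset.mem_filter] at hk
      simp only [← last_eq k hk.1.1 hk.2, Fin.snoc_init_self]
    · intro k hk
      simp
    · intro k hk
      simp only [Finset.mem_filter] at hk
      rw [Fin.prod_univ_castSucc, last_eq k hk.1.1 hk.2, mul_comm]
      rfl

theorem monotone_snoc {m : ℕ} {k : Fin m → ℕ+} {a : ℕ+} :
    Monotone (Fin.snoc k a : Fin (m + 1) → ℕ+) ↔ Monotone k ∧ ∀ i, k i ≤ a := by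
  constructor
  · intro h
    refine ⟨fun i j hij => ?_, fun i => ?_⟩
    · simpa using h (Fin.castSucc_le_castSucc_iff.2 hij)
    · simpa using h (Fin.le_last i.castSucc)
  · rintro ⟨h, ha⟩ i j hij
    induction j using Fin.lastCases with
    | last =>
      induction i using Fin.lastCases with
      | last => exact le_rfl
      | cast i => simpa using ha i
    | cast j =>
      induction i using Fin.lastCases with
      | last => exact absurd hij (not_le.2 (Fin.castSucc_lt_last j))
      | cast i => simpa using h (Fin.castSucc_le_castSucc_iff.1 hij)

theorem strictMono_snoc {m : ℕ} {k : Fin m → ℕ+} {a : ℕ+} :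
    StrictMono (Fin.snoc k a : Fin (m + 1) → ℕ+) ↔ StrictMono k ∧ ∀ i, k i < a := by
  constructor
  · intro h
    refine ⟨fun i j hij => ?_, fun i => ?_⟩
    · simpa using h (Fin.castSucc_lt_castSucc_iff.2 hij)
    · simpa using h (Fin.castSucc_lt_last i)
  · rintro ⟨h, ha⟩ i j hij
    induction j using Fin.lastCases with
    | last =>
      induction i using Fin.lastCases with
      | last => exact absurd hij (lt_irrefl _)
      | cast i => simpa using ha i
    | cast j =>
      induction i using Fin.lastCases with
      | last => exact absurd hij (not_lt.2 (Fin.le_last _))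
      | cast i => simpa using h (Fin.castSucc_lt_castSucc_iff.1 hij)

/-- Once the last entry is N + 1, strictness confines the others to at most N. In the weak case
below, N + 1 may recur, so the bound stays; hence E gains a factor where H loses one. -/
theorem truncSum_strictMono_succ (x : ℕ+ → ℝ) (m N : ℕ) :
    truncSum x (StrictMono : (Fin (m + 1) → ℕ+) → Prop) (N + 1) =
      truncSum x (StrictMono : (Fin (m + 1) → ℕ+) → Prop) N +
        x N.succPNat * truncSum x (StrictMono : (Fin m → ℕ+) → Prop) N := by
  refine truncSum_succ x (fun _ h => h.monotone) fun k => ?_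
  simp only [strictMono_snoc, mem_pnatBox, ← PNat.coe_lt_coe, Nat.succPNat_coe,
    Nat.lt_succ_iff]
  exact ⟨fun h => ⟨fun i => (h.1 i).trans (Nat.le_succ N), h.2, h.1⟩, fun h => ⟨h.2.2, h.2.1⟩⟩

theorem truncSum_monotone_succ (x : ℕ+ → ℝ) (m N : ℕ) :
    truncSum x (Monotone : (Fin (m + 1) → ℕ+) → Prop) (N + 1) =
      truncSum x (Monotone : (Fin (m + 1) → ℕ+) → Prop) N +
        x N.succPNat * truncSum x (Monotone : (Fin m → ℕ+) → Prop) (N + 1) := by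
  refine truncSum_succ x (fun _ h => h) fun k => ?_
  simp only [monotone_snoc, mem_pnatBox, ← PNat.coe_le_coe, Nat.succPNat_coe]
  exact ⟨fun h => ⟨h.1, h.2, h.1⟩, fun h => ⟨h.1, h.2.1⟩⟩

/-- The generating series `∏ (1 - x k * X)` of signed elementary symmetric sums. -/
noncomputable def elemSeries (x : ℕ+ → ℝ) (N : ℕ) : ℝ⟦X⟧ :=
  PowerSeries.mk fun m => (-1) ^ m * truncSum x (StrictMono : (Fin m → ℕ+) → Prop) N

/-- The generating series `∏ (1 - x k * X)⁻¹` of complete homogeneous symmetric sums. -/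
noncomputable def homSeries (x : ℕ+ → ℝ) (N : ℕ) : ℝ⟦X⟧ :=
  PowerSeries.mk fun m => truncSum x (Monotone : (Fin m → ℕ+) → Prop) N

/-- The generating series of power sums. -/
noncomputable def powerSeriesSum (x : ℕ+ → ℝ) (N : ℕ) : ℝ⟦X⟧ :=
  PowerSeries.mk fun n => ∑ k ∈ pnatUpTo N, x k ^ (n + 1)

theorem elemSeries_zero (x : ℕ+ → ℝ) : elemSeries x 0 = 1 := by
  ext m
  cases m with
  | zero => simp [elemSeries, truncSum_depth_zero, Subsingleton.strictMono]
  | succ m => simp [elemSeries, truncSum_zero, PowerSeries.coeff_one]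

theorem homSeries_zero (x : ℕ+ → ℝ) : homSeries x 0 = 1 := by
  ext m
  cases m with
  | zero => simp [homSeries, truncSum_depth_zero, Subsingleton.monotone]
  | succ m => simp [homSeries, truncSum_zero, PowerSeries.coeff_one]

theorem coeff_succ_one_sub_C_mul_X_mul (a : ℝ) (f : ℝ⟦X⟧) (m : ℕ) :
    coeff (m + 1) ((1 - C a * X) * f) = coeff (m + 1) f - a * coeff m f := by
  rw [sub_mul, one_mul, map_sub, mul_assoc, coeff_C_mul, coeff_succ_X_mul]

theorem coeff_zero_one_sub_C_mul_X_mul (a : ℝ) (f : ℝ⟦X⟧) :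
    coeff 0 ((1 - C a * X) * f) = coeff 0 f := by
  simp

theorem elemSeries_succ (x : ℕ+ → ℝ) (N : ℕ) :
    elemSeries x (N + 1) = (1 - C (x N.succPNat) * X) * elemSeries x N := by
  ext m
  cases m with
  | zero =>
    rw [coeff_zero_one_sub_C_mul_X_mul]
    simp [elemSeries, truncSum_depth_zero, Subsingleton.strictMono]
  | succ m =>
    rw [coeff_succ_one_sub_C_mul_X_mul]
    simp only [elemSeries, coeff_mk, truncSum_strictMono_succ]
    ring

theorem homSeries_succ (x : ℕ+ → ℝ) (N : ℕ) :
    (1 - C (x N.succPNat) * X) * homSeries x (N + 1) = homSeries x N := by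
  ext m
  cases m with
  | zero =>
    rw [coeff_zero_one_sub_C_mul_X_mul]
    simp [homSeries, truncSum_depth_zero, Subsingleton.monotone]
  | succ m =>
    rw [coeff_succ_one_sub_C_mul_X_mul]
    simp only [homSeries, coeff_mk, truncSum_monotone_succ]
    ring

theorem one_sub_C_mul_X_mul_geom (a : ℝ) :
    (1 - C a * X) * PowerSeries.mk (fun n => a ^ n) = 1 := by
  ext m
  cases m with
  | zero => rw [coeff_zero_one_sub_C_mul_X_mul]; simp
  | succ m =>
    rw [coeff_succ_one_sub_C_mul_X_mul]
    simp [PowerSeries.coeff_one, pow_succ']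

theorem powerSeriesSum_succ (x : ℕ+ → ℝ) (N : ℕ) :
    powerSeriesSum x (N + 1) = powerSeriesSum x N +
      C (x N.succPNat) * PowerSeries.mk (fun n => x N.succPNat ^ n) := by
  ext n
  simp only [powerSeriesSum, map_add, coeff_mk, coeff_C_mul, pnatUpTo_succ,
    Finset.sum_insert (succPNat_notMem_pnatUpTo N)]
  ring

theorem elemSeries_mul_homSeries (x : ℕ+ → ℝ) (N : ℕ) :
    elemSeries x N * homSeries x N = 1 := by
  induction N with
  | zero => simp [elemSeries_zero, homSeries_zero]
  | succ N ih => rw [elemSeries_succ, mul_right_comm, homSeries_succ, mul_comm, ih]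

theorem neg_derivative_elemSeries_mul_homSeries (x : ℕ+ → ℝ) (N : ℕ) :
    -(d⁄dX ℝ (elemSeries x N)) * homSeries x N = powerSeriesSum x N := by
  induction N with
  | zero =>
    ext n
    simp [elemSeries_zero, powerSeriesSum, pnatUpTo]
  | succ N ih =>
    set a := x N.succPNat with ha
    have hd : d⁄dX ℝ (1 - C a * X) = -C a := by
      simp [Derivation.leibniz]
    -- All factors cancel except that of the new variable, leaving 1 / (1 - aX).
    have hg : elemSeries x N * homSeries x (N + 1) = PowerSeries.mk fun n => a ^ n := by
      have h1 := elemSeries_mul_homSeries x (N + 1)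
      rw [elemSeries_succ, ← ha] at h1
      linear_combination (PowerSeries.mk fun n => a ^ n) * h1 -
        (elemSeries x N * homSeries x (N + 1)) * one_sub_C_mul_X_mul_geom a
    have hh := homSeries_succ x N
    rw [← ha] at hh
    rw [powerSeriesSum_succ, elemSeries_succ, ← ha, Derivation.leibniz, hd, ← ih, ← hg, ← hh]
    simp only [smul_eq_mul]
    ring

/-- The identity between power sums, elementary and complete homogeneous symmetric sums. -/
theorem sum_pow_eq_sum_antidiagonal (x : ℕ+ → ℝ) (n N : ℕ) :
    ∑ k ∈ pnatUpTo N, x k ^ (n + 1) = ∑ p ∈ Finset.HasAntidiagonal.antidiagonal n,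
      (-1 : ℝ) ^ p.2 * ((p.2 : ℝ) + 1) *
        truncSum x (StrictMono : (Fin (p.2 + 1) → ℕ+) → Prop) N *
        truncSum x (Monotone : (Fin p.1 → ℕ+) → Prop) N := by
  have h := congrArg (coeff n) (neg_derivative_elemSeries_mul_homSeries x N)
  rw [mul_comm, coeff_mul] at h
  simp only [powerSeriesSum, coeff_mk] at h
  rw [← h]
  refine Finset.sum_congr rfl fun p _ => ?_
  simp only [homSeries, elemSeries, coeff_mk, map_neg, coeff_derivative]
  ring

/-- The case n = 0 of the identity, where only e₁ h₀ with h₀ = 1 survives. -/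
theorem truncSum_depth_one (x : ℕ+ → ℝ) (N : ℕ) :
    truncSum x (StrictMono : (Fin 1 → ℕ+) → Prop) N = ∑ k ∈ pnatUpTo N, x k := by
  have h := sum_pow_eq_sum_antidiagonal x 0 N
  simpa [truncSum_depth_zero, Subsingleton.monotone] using h.symm

theorem mainTheorem6 (n : ℕ) :
    (MZVConverges ![2 * n + 2] ∧
      (∀ m : ℕ, MZVConverges (repIndex 2 m)) ∧
      (∀ m : ℕ, MZSVConverges (repIndex 2 m))) ∧
    mzv ![2 * n + 2] =
      ∑ p ∈ Finset.HasAntidiagonal.antidiagonal n,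
        (-1 : ℝ) ^ p.2 * ((p.2 : ℝ) + 1) *
          mzv (repIndex 2 (p.2 + 1)) * mzsv (repIndex 2 p.1) := by
  have hα : ∀ i, 2 ≤ (![2 * n + 2] : Fin 1 → ℕ) i := by simp
  have hs (m : ℕ) : Summable (mzvTerm (repIndex 2 m)) := summable_mzvTerm fun _ => le_rfl
  refine ⟨⟨(summable_mzvTerm hα).subtype _, fun m => (hs m).subtype _,
    fun m => (hs m).subtype _⟩, ?_⟩
  let x : ℕ+ → ℝ := fun k => (((k : ℕ) : ℝ) ^ 2)⁻¹
  have hterm (k : Fin 1 → ℕ+) : mzvTerm ![2 * n + 2] k = ∏ i, x (k i) ^ (n + 1) := by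
    simp only [mzvTerm, x, Fin.prod_univ_one, Matrix.cons_val_zero]
    rw [inv_pow, ← pow_mul, mul_add, mul_one]
  have hz : Tendsto (truncSum (fun k => x k ^ (n + 1)) (StrictMono : (Fin 1 → ℕ+) → Prop)) atTop
      (𝓝 (mzv ![2 * n + 2])) := by
    have h := tendsto_truncSum (x := fun k => x k ^ (n + 1))
      (StrictMono : (Fin 1 → ℕ+) → Prop) ((summable_mzvTerm hα).congr hterm)
    simpa only [mzv, hterm] using h
  -- Both sides are limits of the same sequence of power sums of exponent n + 1.
  refine tendsto_nhds_unique (hz.congr fun N =>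
    (truncSum_depth_one _ N).trans (sum_pow_eq_sum_antidiagonal x n N)) ?_
  exact tendsto_finsetSum _ fun p _ =>
    ((tendsto_truncSum (x := x) _ (hs (p.2 + 1))).const_mul _).mul
      (tendsto_truncSum (x := x) _ (hs p.1))
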